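/- All graphs are simple and may be infinite. A graph is infinitely edge-connected if it has more than one vertex and stays connected whenever finitely many edges are deleted. Paths between the same two endvertices are independent if no one of them contains an inner vertex of another. A $\Pi$-graph is an infinitely edge-connected graph that does not contain infinitely many pairwise independent $x$–$y$ paths for any two distinct vertices $x, y$. A subdivided $\Pi$-graph is a graph obtained from a $\Pi$-graph $H$ by replacing each edge $ab$ of $H$ with a finite $a$–$b$ path that has no inner vertex in $V(H)$ or on any of the other new paths; the vertices of $H$ are its branch vertices. For a subgraph $H$ of a graph and a non-empty set $X \subseteq V(H)$, the graph $H[X]$ is the subgraph of $H$ induced by $X$, and $H/X$ is the simple graph obtained from $H$ by contracting $X$ to a single vertex, also denoted $X$; it is adjacent to exactly those vertices in $V(H) \setminus X$ that have a neighbour in $X$ in the graph $H$. **Theorem 6.1.** Let $G$ be a subdivided $\Pi$-graph and let $u, v$ be two distinct branch vertices of $G$. Then there exist subgraphs $H_u, H_v \subseteq G$ such that $X := V(H_u) \cap V(H_v)$ is non-empty and the following conditions are satisfied: 1. $H_u[X] = H_v[X]$, and both induced subgraphs are finite and connected; 2. $u \notin X$ and $v \notin X$; 3. $H_u/X$ is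 a subdivided $\Pi$-graph in which $u$ and $X$ are branch vertices, and $H_v/X$ is a subdivided $\Pi$-graph in which $v$ and $X$ are branch vertices; 4. $uX$ is an edge of $H_u/X$ and $vX$ is an edge of $H_v/X$. -/

import Mathlib

namespace FareyUnique

/-- Two `x`-`y` paths are independent: neither contains an inner vertex of the other, that is,
they have only their endvertices in common. -/
def Independent {V : Type*} {G : SimpleGraph V} {x y : V} (p q : G.Path x y) : Prop :=
  ∀ w : V, w ∈ (p : G.Walk x y).support → w ∈ (q : G.Walk x y).support → w = x ∨ w = y

/-- A graph is infinitely edge-connected if it has more than one vertex and deleting finitely many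
edges never disconnects it. -/
structure InfinitelyEdgeConnected {V : Type*} (G : SimpleGraph V) : Prop where
  nontrivial : Nontrivial V
  isEdgeConnected : ∀ k : ℕ, G.IsEdgeConnected k

/-- A `Π`-graph is an infinitely edge-connected graph that does not contain infinitely many
independent paths between any two of its vertices. -/
structure IsPiGraph {V : Type*} (G : SimpleGraph V) : Prop where
  infinitelyEdgeConnected : InfinitelyEdgeConnected G
  finite_of_independent : ∀ x y : V, x ≠ y → ∀ 𝓢 : Set (G.Path x y),
    𝓢.Pairwise Independent → 𝓢.Finite

/-- `G` is a subdivision of the graph `H`, whose vertex set `B` consists of the branch vertices: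
`G` arises from `H` by replacing every edge `ab` of `H` with an `a`-`b` path of `G`, in such a way
that these paths have no inner vertex in `B` or on another one of the paths. -/
def IsSubdivision {V : Type*} (G : SimpleGraph V) (B : Set V) (H : SimpleGraph B) : Prop :=
  ∃ P : ∀ a b : B, H.Adj a b → G.Walk (a : V) (b : V),
    (∀ a b h, (P a b h).IsPath) ∧
    (∀ a b h, P b a h.symm = (P a b h).reverse) ∧
    (∀ a b h, ∀ w ∈ (P a b h).support, w ∈ B → w = a ∨ w = b) ∧
    (∀ a b h c d h', ∀ w ∈ (P a b h).support, w ∈ (P c d h').support → w ∉ B →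
      s(a, b) = s(c, d)) ∧
    (∀ w : V, w ∉ B → ∃ a b h, w ∈ (P a b h).support) ∧
    (∀ e ∈ G.edgeSet, ∃ a b h, e ∈ (P a b h).edges)

/-- `G` is a subdivided `Π`-graph whose set of branch vertices is `B`. -/
def IsSubdividedPiGraph {V : Type*} (G : SimpleGraph V) (B : Set V) : Prop :=
  ∃ H : SimpleGraph B, IsPiGraph H ∧ IsSubdivision G B H

/-- The contraction `H/X` of a set `X` of vertices in a subgraph `H`, again a simple graph.
Its vertices are the vertices of `H` outside `X`, and the contracted vertex `X`, which is `none`.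
Two vertices outside `X` are adjacent if they are so in `H`, and `X` is adjacent to the
vertices outside `X` that have a neighbour in `X`. -/
def contract {V : Type*} {G : SimpleGraph V} (H : G.Subgraph) (X : Set V) :
    SimpleGraph (Option ↥(H.verts \ X)) where
  Adj
    | some a, some b => H.Adj a b
    | some a, none => ∃ x ∈ X, H.Adj a x
    | none, some b => ∃ x ∈ X, H.Adj b x
    | none, none => False
  symm := ⟨by
    rintro (_ | a) (_ | b) h
    · exact h
    · exact h
    · exact h
    · exact H.adj_symm h⟩
  loopless := ⟨by
    rintro (_ | a) h
    · exact h
    · exact H.loopless.irrefl _ h⟩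

end FareyUnique

/-! ### Edge-linkage, finite separation and Π-graphs. -/

namespace FareyUnique

open SimpleGraph

/-! A graph with at least two vertices is a Π-graph exactly if any two distinct vertices satisfy
both `EdgeLinked` and `FinSep`. Subdividing preserves `FinSep` for all pairs and `EdgeLinked` for
pairs of branch vertices.

Choose a side `R` of `u` in a finite separation from `v`, and the complementary side `R'` of `v`.
Finitely many edges can be deleted so that every remaining `u`–`v` walk leaves `R` at a vertex to
which `u` is linked within `R` (`IsSide.exists_finite_edges`); likewise for `v` and `R'`. Let `p` be
a `u`–`v` path avoiding these edges and the edge `uv`, and let `X` be its set of inner vertices.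
Contracting `X` makes `u` edge-linked to `X` inside `R ∪ X`, and `v` inside `R' ∪ X`. The end edges
of `p` make `u` and `v` adjacent to `X`, and the two pieces overlap only in `X`.

It remains to find a subdivided Π-graph in each contraction. This is
`exists_pathSystem_of_edgeLinked`: take edge-disjoint paths between the two linked vertices that
converge to a vertex set, and cut them into segments at that set. Finite separation lets each pair
of ends occur on only finitely many paths, so the graph formed by the segments has infinite cuts.
`exists_subgraph_of_edgeLinked_contraction` lifts the result back to `G`. -/

/-- Every cut that separates `a` from `b` has infinitely many edges. -/
def EdgeLinked {V : Type*} (G : SimpleGraph V) (a b : V) : Prop :=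
  ∀ A : Set V, a ∈ A → b ∉ A → {p : V × V | p.1 ∈ A ∧ p.2 ∉ A ∧ G.Adj p.1 p.2}.Infinite

/-- The vertices other than `b` that lie outside `R` but have a neighbour in `R`. -/
def boundary {V : Type*} (G : SimpleGraph V) (b : V) (R : Set V) : Set V :=
  {w | w ∉ R ∧ w ≠ b ∧ ∃ z ∈ R, G.Adj z w}

/-- `R` is the side of `a` in a separation of `a` from `b` by finitely many vertices and possibly
the edge `ab`. -/
structure IsSide {V : Type*} (G : SimpleGraph V) (a b : V) (R : Set V) : Prop where
  left_mem : a ∈ R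
  right_notMem : b ∉ R
  eq_of_adj : ∀ w ∈ R, G.Adj w b → w = a
  finite_boundary : (boundary G b R).Finite

/-- Finitely many vertices and possibly the edge `ab` separate `a` from `b`. -/
def FinSep {V : Type*} (G : SimpleGraph V) (a b : V) : Prop := ∃ R, IsSide G a b R

variable {V : Type*} {G : SimpleGraph V} {a b : V}

/-- The same separator serves from the other end: a vertex of `R` with a neighbour beyond the
boundary can only be `a`, through the edge `ab`. -/
theorem IsSide.symm {R : Set V} (h : IsSide G a b R) : IsSide G b a (R ∪ boundary G b R)ᶜ where
  left_mem := by
    rintro (hb | hb)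
    · exact h.right_notMem hb
    · exact hb.2.1 rfl
  right_notMem := fun ha => ha (Or.inl h.left_mem)
  eq_of_adj := by
    intro w hw hwa
    by_contra hne
    exact hw (Or.inr ⟨fun hR => hw (Or.inl hR), hne, a, h.left_mem, hwa.symm⟩)
  finite_boundary := by
    refine h.finite_boundary.subset ?_
    rintro w ⟨hw, hwa, z, hz, hzw⟩
    rcases not_not.1 hw with hR | hR
    · by_cases hzb : z = b
      · subst hzb
        exact absurd (h.eq_of_adj w hR hzw.symm) hwa
      · exact absurd (Or.inr ⟨fun hR' => hz (Or.inl hR'), hzb, w, hR, hzw.symm⟩) hz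
    · exact hR

theorem FinSep.symm (h : FinSep G a b) : FinSep G b a :=
  let ⟨_, hR⟩ := h
  ⟨_, hR.symm⟩

theorem finite_pairs {F : Set (Sym2 V)} (hF : F.Finite) : {p : V × V | s(p.1, p.2) ∈ F}.Finite := by
  have : {p : V × V | s(p.1, p.2) ∈ F} ⊆ ⋃ e ∈ F, {p : V × V | s(p.1, p.2) = e} := by
    intro p hp
    simpa using hp
  refine (hF.biUnion fun e _ => ?_).subset this
  induction e with
  | h x y =>
    refine (Set.toFinite {(x, y), (y, x)}).subset ?_
    rintro ⟨p, q⟩ h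
    simpa using h

theorem EdgeLinked.exists_path (h : EdgeLinked G a b) {F : Set (Sym2 V)} (hF : F.Finite) :
    ∃ p : G.Walk a b, p.IsPath ∧ ∀ e ∈ p.edges, e ∉ F := by
  classical
  by_cases hr : (G.deleteEdges F).Reachable a b
  · obtain ⟨p⟩ := hr
    refine ⟨(p.mapLe (G.deleteEdges_le F)).bypass, Walk.bypass_isPath _, fun e he => ?_⟩
    have h1 := Walk.edges_bypass_subset_edges _ he
    rw [Walk.edges_mapLe_eq_edges] at h1
    have h2 := p.edges_subset_edgeSet h1
    rw [edgeSet_deleteEdges] at h2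
    exact h2.2
  · refine absurd ((finite_pairs hF).subset ?_) (h {w | (G.deleteEdges F).Reachable a w} .rfl hr)
    rintro ⟨x, y⟩ ⟨hx, hy, hxy⟩
    by_contra hxF
    exact hy (Reachable.trans hx (Adj.reachable (by simpa [hxy] using hxF)))

theorem infinitelyEdgeConnected_of_edgeLinked [Nontrivial V]
    (h : ∀ a b, a ≠ b → EdgeLinked G a b) : InfinitelyEdgeConnected G := by
  refine ⟨‹_›, fun k a b F hF => ?_⟩
  by_cases hab : a = b
  · rw [hab]
  have hfin : F.Finite := Set.encard_lt_top_iff.1 (hF.trans_le le_top)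
  obtain ⟨p, -, hp⟩ := (h a b hab).exists_path hfin
  exact ⟨p.toDeleteEdges F hp⟩

theorem Independent.symm {x y : V} {p q : G.Path x y} (h : Independent p q) : Independent q p :=
  fun w hq hp => h w hp hq

theorem exists_edge_of_support_subset {x y : V} (hxy : x ≠ y) (p : G.Walk x y)
    (h : ∀ w ∈ p.support, w = x ∨ w = y) : s(x, y) ∈ p.edges := by
  obtain ⟨d, hd, h1, h2⟩ := p.exists_boundary_dart {x} rfl (fun h => hxy h.symm)
  rcases h _ (p.dart_snd_mem_support_of_mem_darts hd) with h3 | h3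
  · exact absurd h3 h2
  · have := List.mem_map_of_mem (f := Dart.edge) hd
    have h4 : d.edge = s(x, y) := by
      rw [← h3, ← (show d.fst = x from h1)]
      rfl
    rwa [h4] at this

/-- Otherwise the vertices reachable from `x` without using `S` or the edge `xy` would form a side
whose boundary lies in `S`. -/
theorem exists_path_avoiding {x y : V} (hxy : x ≠ y) (hn : ¬ FinSep G x y) {S : Set V}
    (hS : S.Finite) (hxS : x ∉ S) (hyS : y ∉ S) :
    ∃ p : G.Path x y, s(x, y) ∉ (p : G.Walk x y).edges ∧
      ∀ w ∈ (p : G.Walk x y).support, w ∉ S := by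
  classical
  by_contra hno
  refine hn ⟨{w | ∃ p : G.Walk x w, s(x, y) ∉ p.edges ∧ ∀ z ∈ p.support, z ∉ S}, ?_, ?_, ?_, ?_⟩
  · exact ⟨.nil, by simp, by simpa using hxS⟩
  · rintro ⟨p, hp, hpS⟩
    exact hno ⟨p.toPath, fun h => hp (p.edges_bypass_subset_edges h),
      fun w hw => hpS w (p.support_bypass_subset_support hw)⟩
  · rintro w ⟨p, hp, hpS⟩ hwy
    by_contra hwx
    refine hno ⟨(p.concat hwy).toPath, fun h => ?_, fun z hz => ?_⟩
    · have := Walk.edges_bypass_subset_edges _ h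
      rw [Walk.edges_concat] at this
      simp [hp] at this
      grind
    · have := Walk.support_bypass_subset_support _ hz
      rw [Walk.support_concat] at this
      simp at this
      grind
  · refine hS.subset ?_
    rintro w ⟨hw, hwy, z, ⟨p, hp, hpS⟩, hzw⟩
    by_contra hwS
    refine hw ⟨p.concat hzw, ?_, ?_⟩
    · rw [Walk.edges_concat]
      intro h
      simp [hp] at h
      rcases h with h | h
      · exact hwy h.2.symm
      · rw [← h.1] at hw
        exact hw ⟨.nil, by simp, by simpa using hpS x p.start_mem_support⟩
    · intro t ht
      rw [Walk.support_concat] at ht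
      simp at ht
      grind

/-- Without a finite separation, independent paths can be chosen greedily, each avoiding the inner
vertices of its predecessors. -/
theorem finSep_of_finite_independent {x y : V} (hxy : x ≠ y)
    (h : ∀ 𝓢 : Set (G.Path x y), 𝓢.Pairwise Independent → 𝓢.Finite) : FinSep G x y := by
  classical
  by_contra hn
  obtain ⟨f, hf, hr⟩ := exists_seq_of_forall_finset_exists
    (fun p : G.Path x y => s(x, y) ∉ (p : G.Walk x y).edges) Independent (by
      intro s _
      obtain ⟨p, hp, hpS⟩ := exists_path_avoiding hxy hn
        (S := (⋃ q ∈ s, {w | w ∈ (q : G.Walk x y).support}) \ {x, y})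
        (Set.Finite.sdiff (Set.Finite.biUnion s.finite_toSet
          fun q _ => List.finite_toSet (q : G.Walk x y).support)) (by simp) (by simp)
      refine ⟨p, hp, fun q hq w hwq hwp => ?_⟩
      by_contra hw
      refine hpS w hwp ⟨?_, by simpa using hw⟩
      simp only [Set.mem_iUnion]
      exact ⟨q, hq, hwq⟩)
  -- A path independent of itself has no inner vertex, so it would use the edge `xy`, which the
  -- chosen paths avoid.
  have hne : ∀ m n, m < n → f m ≠ f n := by
    intro m n hmn heq
    have h1 := hr m n hmn
    rw [heq] at h1
    exact hf n (exists_edge_of_support_subset hxy _ fun w hw => h1 w hw hw)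
  have hinj : Function.Injective f := by
    intro m n hmn
    by_contra hne'
    rcases lt_or_gt_of_ne hne' with h1 | h1
    · exact hne _ _ h1 hmn
    · exact hne _ _ h1 hmn.symm
  refine Set.infinite_range_of_injective hinj (h _ ?_)
  rintro _ ⟨m, rfl⟩ _ ⟨n, rfl⟩ hmn
  rcases lt_or_gt_of_ne (fun h : m = n => hmn (congrArg f h)) with h1 | h1
  · exact hr _ _ h1
  · exact (hr _ _ h1).symm

theorem support_of_edge_mem {x y : V} (hxy : x ≠ y) {p : G.Walk x y} (hp : p.IsPath)
    (he : s(x, y) ∈ p.edges) : p.support = [x, y] := by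
  cases p with
  | nil => exact absurd rfl hxy
  | cons h q =>
    rw [Walk.cons_isPath_iff] at hp
    rw [Walk.edges_cons, List.mem_cons] at he
    rcases he with he | he
    · have : y = _ := Sym2.congr_right.1 he
      subst this
      rw [(Walk.isPath_iff_nil.1 hp.1).eq_nil]
      simp
    · exact absurd (q.fst_mem_support_of_mem_edges he) hp.2

/-- Each path leaves `R` through the edge `xy` or into a boundary vertex, and independent paths
cannot share either. -/
theorem finite_independent_of_finSep {x y : V} (hxy : x ≠ y) (h : FinSep G x y)
    (𝓢 : Set (G.Path x y)) (hS : 𝓢.Pairwise Independent) : 𝓢.Finite := by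
  obtain ⟨R, hR⟩ := h
  have hsub : 𝓢 ⊆ {p | s(x, y) ∈ (p : G.Walk x y).edges} ∪
      ⋃ w ∈ boundary G y R, {p | p ∈ 𝓢 ∧ w ∈ (p : G.Walk x y).support} := by
    intro p hp
    obtain ⟨d, hd, h1, h2⟩ := (p : G.Walk x y).exists_boundary_dart R hR.left_mem hR.right_notMem
    by_cases hy : d.snd = y
    · left
      have h3 := hR.eq_of_adj _ h1 (hy ▸ d.adj)
      have := List.mem_map_of_mem (f := Dart.edge) hd
      have h4 : d.edge = s(x, y) := by
        rw [← hy, ← h3]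
        rfl
      rwa [h4] at this
    · right
      simp only [Set.mem_iUnion]
      exact ⟨d.snd, ⟨h2, hy, _, h1, d.adj⟩, hp, Walk.dart_snd_mem_support_of_mem_darts _ hd⟩
  refine Set.Finite.subset (Set.Finite.union ?_ (hR.finite_boundary.biUnion fun w hw => ?_)) hsub
  · refine Set.Subsingleton.finite fun p hp q hq => Subtype.ext (Walk.ext_support ?_)
    rw [support_of_edge_mem hxy p.2 hp, support_of_edge_mem hxy q.2 hq]
  · refine Set.Subsingleton.finite fun p hp q hq => ?_
    by_contra hpq
    rcases hS hp.1 hq.1 hpq w hp.2 hq.2 with h1 | h1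
    · exact hw.1 (h1 ▸ hR.left_mem)
    · exact hw.2.1 h1

theorem isPiGraph_of_edgeLinked_of_finSep [Nontrivial V]
    (h : ∀ a b, a ≠ b → EdgeLinked G a b) (h' : ∀ a b, a ≠ b → FinSep G a b) : IsPiGraph G :=
  ⟨infinitelyEdgeConnected_of_edgeLinked h,
    fun x y hxy => finite_independent_of_finSep hxy (h' x y hxy)⟩

end FareyUnique

/-! ### Transfer of linkage and separation through subdivisions. -/

namespace FareyUnique

open SimpleGraph

variable {V : Type*} {G : SimpleGraph V}

/-- The walks `P a b` are paths of `G` that subdivide the edges of a graph `H` whose edges have all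
their ends in the set `C` of branch vertices. -/
structure PathSystem (G : SimpleGraph V) (C : Set V) (H : SimpleGraph V)
    (P : ∀ a b, H.Adj a b → G.Walk a b) : Prop where
  mem : ∀ a b, H.Adj a b → a ∈ C
  isPath : ∀ a b h, (P a b h).IsPath
  reverse : ∀ a b h, P b a h.symm = (P a b h).reverse
  interior : ∀ a b h, ∀ w ∈ (P a b h).support, w ∈ C → w = a ∨ w = b
  disjoint : ∀ a b h c d h', ∀ w ∈ (P a b h).support, w ∈ (P c d h').support → w ∉ C →
    s(a, b) = s(c, d)

/-- The vertices of the path that subdivides the edge `ab`. -/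
def trace {H : SimpleGraph V} (P : ∀ a b, H.Adj a b → G.Walk a b) (a b : V) : Set V :=
  {w | ∃ h, w ∈ (P a b h).support}

section

variable {C : Set V} {H : SimpleGraph V} {P : ∀ a b, H.Adj a b → G.Walk a b}

theorem PathSystem.trace_comm (h : PathSystem G C H P) (a b : V) : trace P a b = trace P b a := by
  have key : ∀ a b, trace P a b ⊆ trace P b a := by
    rintro a b w ⟨hab, hw⟩
    refine ⟨hab.symm, ?_⟩
    rw [h.reverse a b hab, Walk.support_reverse]
    exact List.mem_reverse.2 hw
  exact (key a b).antisymm (key b a)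

theorem finite_trace (P : ∀ a b, H.Adj a b → G.Walk a b) (a b : V) : (trace P a b).Finite := by
  by_cases h : H.Adj a b
  · exact (List.finite_toSet (P a b h).support).subset fun w ⟨_, hw⟩ => hw
  · exact Set.finite_empty.subset fun w ⟨h', _⟩ => h h'

theorem left_mem_trace {a b : V} (h : H.Adj a b) : a ∈ trace P a b := ⟨h, Walk.start_mem_support _⟩

theorem adj_of_mem_trace {a b w : V} (h : w ∈ trace P a b) : H.Adj a b := h.1

theorem PathSystem.eq_or_eq_of_mem_trace (h : PathSystem G C H P) {a b w : V}
    (hw : w ∈ trace P a b) (hC : w ∈ C) : w = a ∨ w = b :=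
  h.interior a b hw.1 w hw.2 hC

theorem PathSystem.ends_eq (h : PathSystem G C H P) {a b c d w : V} (hw : w ∈ trace P a b)
    (hw' : w ∈ trace P c d) (hC : w ∉ C) : a = c ∧ b = d ∨ a = d ∧ b = c :=
  Sym2.eq_iff.1 (h.disjoint a b hw.1 c d hw'.1 w hw.2 hw'.2 hC)

theorem exists_boundary_mem_trace {a b : V} (hab : H.Adj a b) {A : Set V} (ha : a ∈ A)
    (hb : b ∉ A) : ∃ w ∈ A, ∃ w' ∉ A, G.Adj w w' ∧ w ∈ trace P a b ∧ w' ∈ trace P a b := by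
  obtain ⟨d, hd, h1, h2⟩ := (P a b hab).exists_boundary_dart A ha hb
  exact ⟨_, h1, _, h2, d.adj, ⟨hab, Walk.dart_fst_mem_support_of_mem_darts _ hd⟩,
    ⟨hab, Walk.dart_snd_mem_support_of_mem_darts _ hd⟩⟩

/-- The path of each edge of `H` across a cut contains an edge of `G` across it, and the ends of an
edge of `G` lie together on the path of at most one edge of `H`. -/
theorem PathSystem.edgeLinked (h : PathSystem G C H P) {a b : V} (hab : EdgeLinked H a b) :
    EdgeLinked G a b := by
  intro A ha hb hfin
  refine hab A ha hb ?_
  have hsub : {p : V × V | p.1 ∈ A ∧ p.2 ∉ A ∧ H.Adj p.1 p.2} ⊆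
      ⋃ q ∈ {p : V × V | p.1 ∈ A ∧ p.2 ∉ A ∧ G.Adj p.1 p.2},
        {p | q.1 ∈ trace P p.1 p.2 ∧ q.2 ∈ trace P p.1 p.2 ∧ q.1 ≠ q.2} := by
    rintro ⟨c, d⟩ ⟨hc, hd, hcd⟩
    obtain ⟨w, hw, w', hw', hww', h1, h2⟩ := exists_boundary_mem_trace (P := P) hcd hc hd
    simp only [Set.mem_iUnion]
    exact ⟨(w, w'), ⟨hw, hw', hww'⟩, h1, h2, hww'.ne⟩
  refine (hfin.biUnion ?_).subset hsub
  rintro ⟨w, w'⟩ -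
  by_cases hne : {p : V × V | w ∈ trace P p.1 p.2 ∧ w' ∈ trace P p.1 p.2 ∧ w ≠ w'}.Nonempty
  · obtain ⟨⟨c, d⟩, hc, hd, hw⟩ := hne
    refine (Set.toFinite {(c, d), (d, c)}).subset ?_
    rintro ⟨c', d'⟩ ⟨hc', hd', -⟩
    simp only [Set.mem_insert_iff, Set.mem_singleton_iff, Prod.mk.injEq]
    by_cases h1 : w ∈ C
    · by_cases h2 : w' ∈ C
      · have e1 := h.eq_or_eq_of_mem_trace hc h1
        have e2 := h.eq_or_eq_of_mem_trace hc' h1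
        have e3 := h.eq_or_eq_of_mem_trace hd h2
        have e4 := h.eq_or_eq_of_mem_trace hd' h2
        grind
      · exact h.ends_eq hd' hd h2
    · exact h.ends_eq hc' hc h1
  · rw [Set.not_nonempty_iff_eq_empty] at hne
    exact hne ▸ Set.finite_empty

/-- A boundary vertex inside a subdivided edge is replaced by the ends of that edge. These form the
finite set `Z`, which is taken out of `R` except for `a`. -/
theorem PathSystem.finSep_of_finSep_host (h : PathSystem G C H P) {a b : V} (ha : a ∈ C)
    (hb : b ∈ C) (hab : FinSep G a b) : FinSep H a b := by
  obtain ⟨R, hR⟩ := hab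
  set Z : Set V := {c | ∃ w ∈ boundary G b R, w ∉ C ∧ ∃ d, w ∈ trace P c d} with hZ
  have hZfin : Z.Finite := by
    have hsub : Z ⊆ ⋃ w ∈ boundary G b R, {c | w ∉ C ∧ ∃ d, w ∈ trace P c d} := by
      rintro c ⟨w, hw, hwC, hd⟩
      simp only [Set.mem_iUnion]
      exact ⟨w, hw, hwC, hd⟩
    refine (hR.finite_boundary.biUnion fun w _ => ?_).subset hsub
    by_cases hne : {c | w ∉ C ∧ ∃ d, w ∈ trace P c d}.Nonempty
    · obtain ⟨c, hwC, d, hd⟩ := hne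
      refine (Set.toFinite {c, d}).subset ?_
      rintro c' ⟨-, d', hd'⟩
      have := h.ends_eq hd hd' hwC
      simp only [Set.mem_insert_iff, Set.mem_singleton_iff]
      grind
    · rw [Set.not_nonempty_iff_eq_empty] at hne
      exact hne ▸ Set.finite_empty
  refine ⟨R \ (Z \ {a}), ⟨hR.left_mem, fun h => h.2 rfl⟩, fun h => hR.right_notMem h.1, ?_, ?_⟩
  · rintro c ⟨hc, hcZ⟩ hcb
    by_contra hca
    obtain ⟨w, hw, w', hw', hww', h1, h2⟩ :=
      exists_boundary_mem_trace (P := P) hcb hc hR.right_notMem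
    have hcZ' : c ∉ Z := fun h => hcZ ⟨h, hca⟩
    have hcC := h.mem _ _ hcb
    by_cases hwb : w' = b
    · have h3 := hR.eq_of_adj w hw (hwb ▸ hww')
      have := h.eq_or_eq_of_mem_trace h1 (h3 ▸ ha)
      have h4 := hR.right_notMem
      grind
    · by_cases hwC : w' ∈ C
      · have := h.eq_or_eq_of_mem_trace h2 hwC
        grind
      · exact hcZ' ⟨w', ⟨hw', hwb, w, hw, hww'⟩, hwC, b, h2⟩
  · refine (hZfin.union hR.finite_boundary).subset ?_
    rintro d ⟨hd, hdb, c, ⟨hc, hcZ⟩, hcd⟩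
    by_cases hdR : d ∈ R
    · left
      by_contra hdZ
      exact hd ⟨hdR, fun h => hdZ h.1⟩
    · obtain ⟨w, hw, w', hw', hww', h1, h2⟩ := exists_boundary_mem_trace (P := P) hcd hc hdR
      have hdC := h.mem _ _ hcd.symm
      by_cases hwC : w' ∈ C
      · right
        have := h.eq_or_eq_of_mem_trace h2 hwC
        have : w' = d := by grind
        subst this
        exact ⟨hw', hdb, w, hw, hww'⟩
      · left
        have hwb : w' ≠ b := fun h => hwC (h ▸ hb)
        exact ⟨w', ⟨hw', hwb, w, hw, hww'⟩, hwC, c, h.trace_comm c d ▸ h2⟩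

/-- All neighbours of a non-branch vertex lie on the one path through it, so `{a}` is already a
side. -/
theorem PathSystem.finSep_of_notMem (h : PathSystem G C H P)
    (hcov : ∀ w, w ∉ C → ∃ a b, w ∈ trace P a b)
    (hedge : ∀ w w', G.Adj w w' → ∃ a b, w ∈ trace P a b ∧ w' ∈ trace P a b)
    {a b : V} (hab : a ≠ b) (ha : a ∉ C) : FinSep G a b := by
  obtain ⟨c, d, hw⟩ := hcov a ha
  refine ⟨{a}, rfl, fun h => hab h.symm, fun w hw _ => hw, (finite_trace P c d).subset ?_⟩
  rintro w ⟨-, -, z, rfl, hzw⟩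
  obtain ⟨c', d', h1, h2⟩ := hedge z w hzw
  have := h.trace_comm c d
  rcases h.ends_eq hw h1 ha with ⟨rfl, rfl⟩ | ⟨rfl, rfl⟩ <;> grind

/-- The side in `H` is enlarged by the inner vertices of all paths with an end in it, except the
path for `ab`: its finitely many vertices are allowed in the boundary. -/
theorem PathSystem.finSep_of_mem (h : PathSystem G C H P)
    (hedge : ∀ w w', G.Adj w w' → ∃ a b, w ∈ trace P a b ∧ w' ∈ trace P a b)
    {a b : V} (ha : a ∈ C) (hb : b ∈ C) (hab : FinSep H a b) : FinSep G a b := by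
  obtain ⟨R, hR⟩ := hab
  have hbR := hR.right_notMem
  refine ⟨{w | w ∈ C ∧ w ∈ R ∨ w ∉ C ∧ ∃ c ∈ R, ∃ d, ¬ (c = a ∧ d = b) ∧ w ∈ trace P c d},
    Or.inl ⟨ha, hR.left_mem⟩, ?_, ?_, ?_⟩
  · rintro (h1 | h1)
    · exact hbR h1.2
    · exact h1.1 hb
  · intro w hw hwb
    obtain ⟨c, d, h1, h2⟩ := hedge w b hwb
    have hbcd := h.eq_or_eq_of_mem_trace h2 hb
    have hcd := adj_of_mem_trace h1
    have hwne := hwb.ne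
    rcases hw with ⟨hwC, hwR⟩ | ⟨hwC, c', hc', d', hne, hw⟩
    · have h3 := h.eq_or_eq_of_mem_trace h1 hwC
      refine hR.eq_of_adj w hwR ?_
      rcases h3 with rfl | rfl <;> rcases hbcd with rfl | rfl
      · exact absurd rfl hwne
      · exact hcd
      · exact hcd.symm
      · exact absurd rfl hwne
    · have h3 := h.ends_eq h1 hw hwC
      have h4 : d' = b := by grind
      subst h4
      exact absurd ⟨hR.eq_of_adj c' hc' (adj_of_mem_trace hw), rfl⟩ hne
  · refine (hR.finite_boundary.union (finite_trace P a b)).subset ?_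
    rintro w' ⟨hw', hwb, w, hw, hww'⟩
    obtain ⟨c, d, h1, h2⟩ := hedge w w' hww'
    have hcd := adj_of_mem_trace h1
    have hcomm := h.trace_comm c d
    rcases hw with ⟨hwC, hwR⟩ | ⟨hwC, c', hc', d', hne, hw⟩
    · wlog hwc : w = c generalizing c d
      · have h3 := h.eq_or_eq_of_mem_trace h1 hwC
        exact this d c (hcomm ▸ h1) (hcomm ▸ h2) hcd.symm hcomm.symm (by grind)
      subst hwc
      by_cases hC : w' ∈ C
      · left
        have h3 := h.eq_or_eq_of_mem_trace h2 hC
        have h4 : w' = d := h3.resolve_left hww'.ne'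
        subst h4
        exact ⟨fun h => hw' (Or.inl ⟨hC, h⟩), hwb, w, hwR, hcd⟩
      · by_cases hpair : w = a ∧ d = b
        · right
          rw [← hpair.1, ← hpair.2]
          exact h2
        · exact absurd (Or.inr ⟨hC, w, hwR, d, hpair, h2⟩) hw'
    · have h2' : w' ∈ trace P c' d' := by
        have := h.ends_eq h1 hw hwC
        grind
      by_cases hC : w' ∈ C
      · left
        have h3 := h.eq_or_eq_of_mem_trace h2' hC
        have hw'R : w' ∉ R := fun h => hw' (Or.inl ⟨hC, h⟩)
        have h4 : w' = d' := h3.resolve_left fun h => hw'R (h ▸ hc')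
        subst h4
        exact ⟨hw'R, hwb, c', hc', adj_of_mem_trace hw⟩
      · exact absurd (Or.inr ⟨hC, c', hc', d', hne, h2'⟩) hw'

end

theorem IsPiGraph.edgeLinked {H : SimpleGraph V} (h : IsPiGraph H) {a b : V} : EdgeLinked H a b := by
  intro A ha hb hfin
  set F : Set (Sym2 V) := (fun p : V × V => s(p.1, p.2)) ''
    {p | p.1 ∈ A ∧ p.2 ∉ A ∧ H.Adj p.1 p.2} with hF
  have hFfin : F.Finite := hfin.image _
  have hcard : F.encard < (F.ncard + 1 : ℕ) := by
    rw [← hFfin.cast_ncard_eq]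
    exact_mod_cast Nat.lt_succ_self _
  obtain ⟨p⟩ := h.infinitelyEdgeConnected.isEdgeConnected _ a b hcard
  obtain ⟨d, -, h1, h2⟩ := p.exists_boundary_dart A ha hb
  have h3 := d.adj
  rw [deleteEdges_adj] at h3
  exact h3.2 ⟨(d.fst, d.snd), ⟨h1, h2, h3.1⟩, rfl⟩

theorem EdgeLinked.map {W : Type*} {H : SimpleGraph W} (f : W ↪ V) {a b : W}
    (h : EdgeLinked H a b) : EdgeLinked (H.map f) (f a) (f b) := by
  intro A ha hb hfin
  refine h (f ⁻¹' A) ha hb ?_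
  refine (hfin.preimage (f := Prod.map f f) (f.injective.prodMap f.injective).injOn).subset ?_
  rintro ⟨c, d⟩ ⟨hc, hd, hcd⟩
  exact ⟨hc, hd, by simpa using hcd⟩

theorem FinSep.map {W : Type*} {H : SimpleGraph W} (f : W ↪ V) {a b : W}
    (h : FinSep H a b) : FinSep (H.map f) (f a) (f b) := by
  obtain ⟨R, hR⟩ := h
  refine ⟨f '' R, ⟨a, hR.left_mem, rfl⟩, ?_, ?_, ?_⟩
  · rintro ⟨c, hc, hcb⟩
    exact hR.right_notMem (f.injective hcb ▸ hc)
  · rintro _ ⟨c, hc, rfl⟩ hcb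
    rw [hR.eq_of_adj c hc (by simpa using hcb)]
  · refine (hR.finite_boundary.image f).subset ?_
    rintro w ⟨hw, hwb, _, ⟨c, hc, rfl⟩, hcw⟩
    obtain ⟨c', d, hcd, h1, rfl⟩ := (map_adj _ _ _ _).1 hcw
    obtain rfl := f.injective h1
    exact ⟨d, ⟨fun h => hw ⟨d, h, rfl⟩, fun h => hwb (h ▸ rfl), c', hc, hcd⟩, rfl⟩

theorem IsSubdividedPiGraph.exists_pathSystem {B : Set V} (h : IsSubdividedPiGraph G B) :
    ∃ (H : SimpleGraph V) (P : ∀ a b, H.Adj a b → G.Walk a b), PathSystem G B H P ∧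
      (∀ w, w ∉ B → ∃ a b, w ∈ trace P a b) ∧
      (∀ w w', G.Adj w w' → ∃ a b, w ∈ trace P a b ∧ w' ∈ trace P a b) ∧
      (∀ a ∈ B, ∀ b ∈ B, EdgeLinked H a b) ∧ (∀ a ∈ B, ∀ b ∈ B, a ≠ b → FinSep H a b) := by
  obtain ⟨H, hH, P, hpath, hrev, hint, hdis, hcov, hedge⟩ := h
  have hadj : ∀ {a b}, (H.map (Function.Embedding.subtype _)).Adj a b →
      ∃ (ha : a ∈ B) (hb : b ∈ B), H.Adj ⟨a, ha⟩ ⟨b, hb⟩ := by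
    intro a b hab
    obtain ⟨c, d, hcd, rfl, rfl⟩ := (map_adj _ _ _ _).1 hab
    exact ⟨c.2, d.2, hcd⟩
  have hadj' : ∀ a b : B, H.Adj a b → (H.map (Function.Embedding.subtype _)).Adj (a : V) (b : V) :=
    fun a b hab => (map_adj _ _ _ _).2 ⟨a, b, hab, rfl, rfl⟩
  refine ⟨H.map (Function.Embedding.subtype _),
    fun a b hab => P ⟨a, (hadj hab).1⟩ ⟨b, (hadj hab).2.1⟩ (hadj hab).2.2,
    ⟨fun a b hab => (hadj hab).1, fun a b hab => hpath _ _ _, fun a b hab => hrev _ _ _,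
      fun a b hab => hint _ _ _, fun a b hab c d hcd w h1 h2 h3 => ?_⟩, ?_, ?_, ?_, ?_⟩
  · have := congrArg (Sym2.map Subtype.val) (hdis _ _ _ _ _ _ w h1 h2 h3)
    simpa using this
  · intro w hw
    obtain ⟨a, b, hab, h1⟩ := hcov w hw
    exact ⟨a, b, hadj' _ _ hab, h1⟩
  · intro w w' hww'
    obtain ⟨a, b, hab, h1⟩ := hedge s(w, w') hww'
    exact ⟨a, b, ⟨hadj' _ _ hab, Walk.fst_mem_support_of_mem_edges _ h1⟩,
      ⟨hadj' _ _ hab, Walk.snd_mem_support_of_mem_edges _ h1⟩⟩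
  · intro a ha b hb
    exact EdgeLinked.map (Function.Embedding.subtype _) (a := ⟨a, ha⟩) (b := ⟨b, hb⟩) hH.edgeLinked
  · intro a ha b hb hab
    have hab' : (⟨a, ha⟩ : B) ≠ ⟨b, hb⟩ := fun h => hab (congrArg Subtype.val h)
    exact FinSep.map (Function.Embedding.subtype _) (a := ⟨a, ha⟩) (b := ⟨b, hb⟩)
      (finSep_of_finite_independent hab' (hH.finite_of_independent _ _ hab'))

theorem IsSubdividedPiGraph.finSep {B : Set V} (h : IsSubdividedPiGraph G B) {a b : V}
    (hab : a ≠ b) : FinSep G a b := by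
  obtain ⟨H, P, hP, hcov, hedge, -, hsep⟩ := h.exists_pathSystem
  by_cases ha : a ∈ B
  · by_cases hb : b ∈ B
    · exact hP.finSep_of_mem hedge ha hb (hsep a ha b hb hab)
    · exact (hP.finSep_of_notMem hcov hedge hab.symm hb).symm
  · exact hP.finSep_of_notMem hcov hedge hab ha

theorem IsSubdividedPiGraph.edgeLinked {B : Set V} (h : IsSubdividedPiGraph G B) {a b : V}
    (ha : a ∈ B) (hb : b ∈ B) : EdgeLinked G a b := by
  obtain ⟨H, P, hP, -, -, hlink, -⟩ := h.exists_pathSystem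
  exact hP.edgeLinked (hlink a ha b hb)

end FareyUnique

/-! ### Convergent sequences of edge-disjoint paths and their segments. -/

namespace FareyUnique

open SimpleGraph Filter

variable {V : Type*} {G : SimpleGraph V}

/-- Infinitely edge-linked vertices are joined by a sequence of pairwise edge-disjoint paths that
converges: a vertex of one of the paths lies on all later ones if it is in `C`, and on none of them
otherwise. -/
theorem EdgeLinked.exists_convergent_paths {x y : V} (h : EdgeLinked G x y) :
    ∃ (C : Set V) (p : ℕ → G.Path x y), x ∈ C ∧ y ∈ C ∧
      (∀ m n, m < n → ∀ e ∈ (p m : G.Walk x y).edges, e ∉ (p n : G.Walk x y).edges) ∧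
      ∀ m n, m < n → ∀ z ∈ (p m : G.Walk x y).support,
        (z ∈ C ↔ z ∈ (p n : G.Walk x y).support) := by
  classical
  -- Edge-linkage makes the sets of paths avoiding a given finite edge set generate a proper filter.
  have hne : (⨅ F : Finset (Sym2 V),
      𝓟 {p : G.Path x y | ∀ e ∈ (p : G.Walk x y).edges, e ∉ F}).NeBot := by
    have : Nonempty (G.Path x y) := by
      obtain ⟨p, hp, -⟩ := h.exists_path Set.finite_empty
      exact ⟨⟨p, hp⟩⟩
    refine iInf_neBot_of_directed ?_ fun F => ?_
    · intro F F'
      refine ⟨F ∪ F', ?_, ?_⟩ <;>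
      · simp only [ge_iff_le, le_principal_iff, mem_principal]
        intro p hp e he hF
        exact hp e he (by simp [hF])
    · obtain ⟨p, hp, hpF⟩ := h.exists_path F.finite_toSet
      exact principal_neBot_iff.2 ⟨⟨p, hp⟩, hpF⟩
  set U := Ultrafilter.of (⨅ F : Finset (Sym2 V),
      𝓟 {p : G.Path x y | ∀ e ∈ (p : G.Walk x y).edges, e ∉ F}) with hU
  have hedge : ∀ e : Sym2 V, ∀ᶠ p : G.Path x y in (U : Filter (G.Path x y)), e ∉ (p : G.Walk x y).edges := by
    intro e
    have h1 : {p : G.Path x y | ∀ e' ∈ (p : G.Walk x y).edges, e' ∉ ({e} : Finset (Sym2 V))} ∈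
        (U : Filter (G.Path x y)) :=
      Ultrafilter.of_le _ (mem_iInf_of_mem {e} (mem_principal_self _))
    filter_upwards [h1] with p hp he
    exact hp e he (by simp)
  -- The ultrafilter decides for every vertex whether almost all paths contain it. Finitely many
  -- such decisions can be met at once, which drives the recursive choice below.
  set C : Set V := {z | ∀ᶠ p : G.Path x y in (U : Filter (G.Path x y)), z ∈ (p : G.Walk x y).support} with hC
  have hiff : ∀ z, ∀ᶠ p : G.Path x y in (U : Filter (G.Path x y)), (z ∈ C ↔ z ∈ (p : G.Walk x y).support) := by
    intro z
    by_cases hz : z ∈ C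
    · filter_upwards [hz] with p hp
      simp [hz, hp]
    · filter_upwards [Ultrafilter.eventually_not.2 hz] with p hp
      simp [hz, hp]
  obtain ⟨f, -, hf⟩ := exists_seq_of_forall_finset_exists (fun _ : G.Path x y => True)
    (fun p q => (∀ e ∈ (p : G.Walk x y).edges, e ∉ (q : G.Walk x y).edges) ∧
      ∀ z ∈ (p : G.Walk x y).support, (z ∈ C ↔ z ∈ (q : G.Walk x y).support)) (by
    intro s _
    have hev : ∀ p ∈ s, ∀ᶠ q : G.Path x y in (U : Filter (G.Path x y)),
        (∀ e ∈ (p : G.Walk x y).edges, e ∉ (q : G.Walk x y).edges) ∧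
        ∀ z ∈ (p : G.Walk x y).support, (z ∈ C ↔ z ∈ (q : G.Walk x y).support) := by
      intro p _
      exact ((eventually_all_finite (List.finite_toSet (p : G.Walk x y).edges)).2
        fun e _ => hedge e).and
        ((eventually_all_finite (List.finite_toSet (p : G.Walk x y).support)).2 fun z _ => hiff z)
    obtain ⟨q, hq⟩ := ((eventually_all_finset s).2 hev).exists
    exact ⟨q, trivial, hq⟩)
  exact ⟨C, f, Eventually.of_forall fun p => Walk.start_mem_support _,
    Eventually.of_forall fun p => Walk.end_mem_support _,
    fun m n hmn => (hf m n hmn).1, fun m n hmn => (hf m n hmn).2⟩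

/-- The part of the walk `p` between its `i`-th and `j`-th vertex has its ends but no inner
vertices in `C`. -/
structure IsSegment (C : Set V) {x y : V} (p : G.Walk x y) (i j : ℕ) : Prop where
  lt : i < j
  le : j ≤ p.length
  left_mem : p.getVert i ∈ C
  right_mem : p.getVert j ∈ C
  notMem : ∀ k, i < k → k < j → p.getVert k ∉ C

theorem exists_walk_getVert {x y : V} {p : G.Walk x y} (hp : p.IsPath) {i j : ℕ} (hij : i ≤ j) :
    ∃ q : G.Walk (p.getVert i) (p.getVert j), q.IsPath ∧
      ∀ w ∈ q.support, ∃ k, i ≤ k ∧ k ≤ j ∧ w = p.getVert k := by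
  have hend : (p.drop i).getVert (j - i) = p.getVert j := by
    rw [Walk.drop_getVert]
    congr 1
    omega
  refine ⟨((p.drop i).take (j - i)).copy rfl hend, ?_, ?_⟩
  · rw [Walk.isPath_copy]
    exact (hp.drop i).take _
  · intro w hw
    rw [Walk.support_copy, Walk.mem_support_iff_exists_getVert] at hw
    obtain ⟨n, rfl, -⟩ := hw
    rw [Walk.take_getVert, Walk.drop_getVert]
    exact ⟨_, by omega, by omega, rfl⟩

/-- Splitting at an intermediate index satisfying `P`, the truth value of `Q` must change on one of
the two halves. -/
theorem exists_consecutive {P Q : ℕ → Prop} {i j : ℕ} (hij : i < j) (hi : P i) (hj : P j)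
    (hQ : ¬ (Q i ↔ Q j)) : ∃ k l, k < l ∧ l ≤ j ∧ P k ∧ P l ∧
      (∀ m, k < m → m < l → ¬ P m) ∧ ¬ (Q k ↔ Q l) := by
  induction hn : j - i using Nat.strong_induction_on generalizing i j with
  | _ n ih =>
    by_cases h : ∃ m, i < m ∧ m < j ∧ P m
    · obtain ⟨m, h1, h2, hm⟩ := h
      by_cases hQm : Q i ↔ Q m
      · exact ih (j - m) (by omega) h2 hm hj (by tauto) rfl
      · obtain ⟨k, l, a, b, c⟩ := ih (m - i) (by omega) h1 hi hm hQm rfl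
        exact ⟨k, l, a, by omega, c⟩
    · exact ⟨i, j, hij, le_rfl, hi, hj, fun m h1 h2 hm => h ⟨m, h1, h2, hm⟩, hQ⟩

theorem exists_step {P : ℕ → Prop} {i j : ℕ} (hij : i ≤ j) (hi : P i) (hj : ¬ P j) :
    ∃ k, i ≤ k ∧ k < j ∧ P k ∧ ¬ P (k + 1) := by
  induction j, hij using Nat.le_induction with
  | base => exact absurd hi hj
  | succ n hn ih =>
    by_cases h : P n
    · exact ⟨n, hn, n.lt_succ_self, h, hj⟩
    · obtain ⟨k, h1, h2, h3⟩ := ih h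
      exact ⟨k, h1, by omega, h3⟩

/-- A segment from `c` to `d` leaves `R` through the edge `cd` or at an inner vertex in the finite
boundary. The edge lies on at most one path by disjointness, and so does each such vertex, being
outside `C`, by convergence. -/
theorem finite_segments_of_finSep {x y : V} {C : Set V} {p : ℕ → G.Path x y}
    (hedge : ∀ m n, m < n → ∀ e ∈ (p m : G.Walk x y).edges, e ∉ (p n : G.Walk x y).edges)
    (hconv : ∀ m n, m < n → ∀ z ∈ (p m : G.Walk x y).support,
      (z ∈ C ↔ z ∈ (p n : G.Walk x y).support))
    {c d : V} (hcd : FinSep G c d) :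
    {n | ∃ i j, IsSegment C (p n : G.Walk x y) i j ∧ (p n : G.Walk x y).getVert i = c ∧
      (p n : G.Walk x y).getVert j = d}.Finite := by
  obtain ⟨R, hR⟩ := hcd
  have hsub : {n | ∃ i j, IsSegment C (p n : G.Walk x y) i j ∧ (p n : G.Walk x y).getVert i = c ∧
      (p n : G.Walk x y).getVert j = d} ⊆ {n | s(c, d) ∈ (p n : G.Walk x y).edges} ∪
      ⋃ w ∈ boundary G d R, {n | w ∉ C ∧ w ∈ (p n : G.Walk x y).support} := by
    rintro n ⟨i, j, hseg, rfl, rfl⟩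
    have hlt := hseg.lt
    have hle := hseg.le
    obtain ⟨k, hik, hkj, hk, hk'⟩ := exists_step (P := fun k => (p n : G.Walk x y).getVert k ∈ R)
      hlt.le hR.left_mem hR.right_notMem
    have hadj := (p n : G.Walk x y).adj_getVert_succ (i := k) (by omega)
    rcases eq_or_lt_of_le (Nat.succ_le_of_lt hkj) with hj | hj
    · left
      have hj' : k + 1 = j := hj
      rw [hj'] at hadj
      have hki := hR.eq_of_adj _ hk hadj
      have hki' : k = i := (p n).2.getVert_injOn (by simp; omega) (by simp; omega) hki
      rw [← hj', ← hki']
      exact (Walk.mk_mem_edges_iff_exists _).2 ⟨k, by omega, rfl⟩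
    · right
      simp only [Set.mem_iUnion]
      refine ⟨(p n : G.Walk x y).getVert (k + 1), ⟨hk', fun h => ?_, _, hk, hadj⟩,
        hseg.notMem _ (by omega) hj, Walk.getVert_mem_support _ _⟩
      have : k + 1 = j := (p n).2.getVert_injOn (by simp; omega) (by simp; omega) h
      omega
  refine (Set.Finite.union ?_ (hR.finite_boundary.biUnion fun w _ => ?_)).subset hsub
  · refine Set.Subsingleton.finite fun m hm n hn => ?_
    by_contra hne
    rcases lt_or_gt_of_ne hne with h | h
    · exact hedge _ _ h _ hm hn
    · exact hedge _ _ h _ hn hm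
  · refine Set.Subsingleton.finite fun m hm n hn => ?_
    by_contra hne
    rcases lt_or_gt_of_ne hne with h | h
    · exact hm.1 ((hconv _ _ h _ hm.2).2 hn.2)
    · exact hm.1 ((hconv _ _ h _ hn.2).2 hm.2)

/-- A linear order on `V` fixes the direction in which each walk is chosen; the other direction gets
its reverse. -/
theorem exists_symmetric_walks (H : SimpleGraph V) (Q : ∀ a b, G.Walk a b → Prop)
    (hrev : ∀ a b q, Q a b q → Q b a q.reverse) (hex : ∀ a b, H.Adj a b → ∃ q, Q a b q) :
    ∃ P : ∀ a b, H.Adj a b → G.Walk a b, (∀ a b h, Q a b (P a b h)) ∧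
      ∀ a b h, P b a h.symm = (P a b h).reverse := by
  classical
  obtain ⟨_, -⟩ := exists_wellFoundedLT V
  choose q hq using hex
  refine ⟨fun a b h => if a < b then q a b h else (q b a h.symm).reverse, ?_, ?_⟩
  · intro a b h
    dsimp only
    split_ifs
    · exact hq a b h
    · exact hrev _ _ _ (hq b a h.symm)
  · intro a b h
    dsimp only
    rcases lt_or_gt_of_ne h.ne with h1 | h1
    · rw [if_neg h1.not_gt, if_pos h1]
    · rw [if_pos h1, if_neg h1.not_gt, Walk.reverse_reverse]

end FareyUnique

/-! ### The Π-graph formed by the segments. -/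

namespace FareyUnique

open SimpleGraph

variable {V : Type*} {G : SimpleGraph V}

/-- The candidates for the path that subdivides the edge `ab`: the edge `xy` itself, and the
segments of the paths `p n` between vertices of `C`. -/
def IsCandidate (C : Set V) {x y : V} (p : ℕ → G.Path x y) (a b : V) (q : G.Walk a b) : Prop :=
  q.IsPath ∧ (s(a, b) = s(x, y) ∧ s(a, b) ∈ q.edges ∨ s(a, b) ≠ s(x, y) ∧
    ∃ n i j, IsSegment C (p n : G.Walk x y) i j ∧
      s((p n : G.Walk x y).getVert i, (p n : G.Walk x y).getVert j) = s(a, b) ∧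
      ∀ w ∈ q.support, ∃ k, i ≤ k ∧ k ≤ j ∧ w = (p n : G.Walk x y).getVert k)

section

variable {C : Set V} {x y : V} {p : ℕ → G.Path x y} {a b c d w : V} {q : G.Walk a b}

theorem IsCandidate.reverse (h : IsCandidate C p a b q) : IsCandidate C p b a q.reverse := by
  obtain ⟨h1, h2⟩ := h
  refine ⟨h1.reverse, ?_⟩
  rw [Sym2.eq_swap (a := b) (b := a)]
  simpa using h2

theorem IsSegment.eq_left_or_eq_right {r : G.Walk x y} {i j k : ℕ} (h : IsSegment C r i j)
    (hik : i ≤ k) (hkj : k ≤ j) (hk : r.getVert k ∈ C) : k = i ∨ k = j := by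
  by_contra hne
  exact h.notMem k (by omega) (by omega) hk

theorem IsCandidate.mem_or_eq (h : IsCandidate C p a b q) (hab : a ≠ b) (hw : w ∈ q.support) :
    w = a ∨ w = b ∨ w ∉ C := by
  obtain ⟨h1, ⟨-, h2⟩ | ⟨-, n, i, j, hseg, hs, hq⟩⟩ := h
  · rw [support_of_edge_mem hab h1 h2] at hw
    simp at hw
    tauto
  · by_cases hC : w ∈ C
    · obtain ⟨k, hk1, hk2, rfl⟩ := hq w hw
      rcases Sym2.eq_iff.1 hs with ⟨rfl, rfl⟩ | ⟨rfl, rfl⟩ <;>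
      rcases hseg.eq_left_or_eq_right hk1 hk2 hC with rfl | rfl <;> simp
    · exact Or.inr (Or.inr hC)

theorem IsSegment.eq_of_getVert {r : G.Walk x y} (hr : r.IsPath) {i j i' j' k k' : ℕ}
    (h : IsSegment C r i j) (h' : IsSegment C r i' j') (hik : i ≤ k) (hkj : k ≤ j) (hik' : i' ≤ k')
    (hkj' : k' ≤ j') (hk : r.getVert k ∉ C) (hkk : r.getVert k = r.getVert k') :
    i = i' ∧ j = j' := by
  have hle := h.le
  have hle' := h'.le
  have : k = k' := hr.getVert_injOn (by simp; omega) (by simp; omega) hkk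
  subst this
  have h1 : k ≠ i := fun e => hk (e ▸ h.left_mem)
  have h2 : k ≠ j := fun e => hk (e ▸ h.right_mem)
  have h3 : k ≠ i' := fun e => hk (e ▸ h'.left_mem)
  have h4 : k ≠ j' := fun e => hk (e ▸ h'.right_mem)
  constructor
  · by_contra hne
    rcases lt_or_gt_of_ne hne with hlt | hlt
    · exact h.notMem i' hlt (by omega) h'.left_mem
    · exact h'.notMem i hlt (by omega) h.left_mem
  · by_contra hne
    rcases lt_or_gt_of_ne hne with hlt | hlt
    · exact h'.notMem j (by omega) hlt h.right_mem
    · exact h.notMem j' (by omega) hlt h'.right_mem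

/-- A vertex outside `C` lies on only one path `p n` by convergence, and within that path inside
only one segment; the edge `xy` has no such vertex. -/
theorem IsCandidate.ends_eq {q' : G.Walk c d}
    (hx : x ∈ C) (hy : y ∈ C)
    (hconv : ∀ m n, m < n → ∀ z ∈ (p m : G.Walk x y).support,
      (z ∈ C ↔ z ∈ (p n : G.Walk x y).support))
    (h : IsCandidate C p a b q) (h' : IsCandidate C p c d q') (hab : a ≠ b) (hcd : c ≠ d)
    (hw : w ∈ q.support) (hw' : w ∈ q'.support) (hwC : w ∉ C) : s(a, b) = s(c, d) := by
  obtain ⟨h1, ⟨e, h2⟩ | ⟨-, n, i, j, hseg, hs, hq⟩⟩ := h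
  · rw [support_of_edge_mem hab h1 h2] at hw
    have := Sym2.eq_iff.1 e
    simp at hw
    grind
  obtain ⟨h1', ⟨e, h2'⟩ | ⟨-, n', i', j', hseg', hs', hq'⟩⟩ := h'
  · rw [support_of_edge_mem hcd h1' h2'] at hw'
    have := Sym2.eq_iff.1 e
    simp at hw'
    grind
  obtain ⟨k, hk1, hk2, rfl⟩ := hq w hw
  obtain ⟨k', hk1', hk2', hkk⟩ := hq' _ hw'
  have hnn : n = n' := by
    by_contra hne
    rcases lt_or_gt_of_ne hne with hlt | hlt
    · exact hwC ((hconv _ _ hlt _ (Walk.getVert_mem_support _ _)).2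
        (hkk ▸ Walk.getVert_mem_support _ _))
    · exact hwC ((hconv _ _ hlt _ (hkk ▸ Walk.getVert_mem_support _ _)).2
        (Walk.getVert_mem_support _ _))
  subst hnn
  obtain ⟨rfl, rfl⟩ := hseg.eq_of_getVert (p n).2 hseg' hk1 hk2 hk1' hk2' hwC hkk
  rw [← hs, hs']

theorem IsSegment.getVert_ne {r : G.Walk x y} (hr : r.IsPath) {i j : ℕ} (h : IsSegment C r i j) :
    r.getVert i ≠ r.getVert j := by
  intro he
  have h1 := h.lt
  have h2 := h.le
  have : i = j := hr.getVert_injOn (by simp; omega) (by simp; omega) he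
  omega

theorem exists_isPath_edge_mem {a b : V} (h : G.Adj a b) :
    ∃ q : G.Walk a b, q.IsPath ∧ s(a, b) ∈ q.edges :=
  ⟨h.toWalk, by simp [h.ne], by simp⟩

theorem IsSegment.exists_isCandidate {n i j : ℕ} (hxy : G.Adj x y)
    (h : IsSegment C (p n : G.Walk x y) i j) :
    ∃ q, IsCandidate C p ((p n : G.Walk x y).getVert i) ((p n : G.Walk x y).getVert j) q := by
  by_cases hs : s((p n : G.Walk x y).getVert i, (p n : G.Walk x y).getVert j) = s(x, y)
  · have hadj : G.Adj ((p n : G.Walk x y).getVert i) ((p n : G.Walk x y).getVert j) := by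
      rwa [← mem_edgeSet, hs]
    obtain ⟨q, hq, he⟩ := exists_isPath_edge_mem hadj
    exact ⟨q, hq, Or.inl ⟨hs, he⟩⟩
  · obtain ⟨q, hq, hsup⟩ := exists_walk_getVert (p n).2 h.lt.le
    exact ⟨q, hq, Or.inr ⟨hs, n, i, j, h, rfl, hsup⟩⟩

end

/-- In a graph in which any two vertices are finitely separated, any edge between edge-linked
vertices is an edge, not subdivided, of a subdivision of an infinitely edge-connected graph. -/
theorem exists_pathSystem_of_edgeLinked (hsep : ∀ a b, a ≠ b → FinSep G a b) {x y : V}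
    (hlink : EdgeLinked G x y) (hxy : G.Adj x y) :
    ∃ (C : Set V) (H : SimpleGraph V) (P : ∀ a b, H.Adj a b → G.Walk a b),
      PathSystem G C H P ∧ x ∈ C ∧ y ∈ C ∧ (∃ h : H.Adj x y, s(x, y) ∈ (P x y h).edges) ∧
      (∀ a ∈ C, ∀ b ∈ C, EdgeLinked H a b) ∧ (∀ a ∈ C, ∀ b ∈ C, a ≠ b → FinSep H a b) := by
  obtain ⟨C, p, hx, hy, hedge, hconv⟩ := hlink.exists_convergent_paths
  let H : SimpleGraph V :=
    { Adj := fun a b => a ≠ b ∧ ∃ q, IsCandidate C p a b q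
      symm := ⟨fun a b ⟨h, q, hq⟩ => ⟨h.symm, _, hq.reverse⟩⟩
      loopless := ⟨fun a h => h.1 rfl⟩ }
  obtain ⟨P, hP, hrev⟩ := exists_symmetric_walks H (IsCandidate C p)
    (fun a b q hq => hq.reverse) (fun a b h => h.2)
  -- Vertices of `C` on none of the chosen paths need not be linked to anything, so only `C ∩ U`
  -- serves as the set of branch vertices.
  set U : Set V := {z | ∃ n, z ∈ (p n : G.Walk x y).support} with hU
  have hxU : x ∈ U := ⟨0, Walk.start_mem_support _⟩
  have hyU : y ∈ U := ⟨0, Walk.end_mem_support _⟩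
  have hmem : ∀ a b, H.Adj a b → a ∈ C ∩ U := by
    rintro a b ⟨-, q, -, ⟨hs, -⟩ | ⟨-, n, i, j, hseg, hs, -⟩⟩
    · rcases Sym2.eq_iff.1 hs with ⟨rfl, rfl⟩ | ⟨rfl, rfl⟩
      · exact ⟨hx, hxU⟩
      · exact ⟨hy, hyU⟩
    · rcases Sym2.eq_iff.1 hs with ⟨rfl, rfl⟩ | ⟨rfl, rfl⟩
      · exact ⟨hseg.left_mem, n, Walk.getVert_mem_support _ _⟩
      · exact ⟨hseg.right_mem, n, Walk.getVert_mem_support _ _⟩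
  have hsupp : ∀ a b h, ∀ w ∈ (P a b h).support, w ∈ U := by
    intro a b h w hw
    obtain ⟨h1, ⟨-, h2⟩ | ⟨-, n, i, j, -, -, hq⟩⟩ := hP a b h
    · rw [support_of_edge_mem h.ne h1 h2] at hw
      have h3 := (hmem a b h).2
      have h4 := (hmem b a h.symm).2
      simp at hw
      rcases hw with rfl | rfl
      · exact h3
      · exact h4
    · obtain ⟨k, -, -, rfl⟩ := hq w hw
      exact ⟨n, Walk.getVert_mem_support _ _⟩
  have hsys : PathSystem G (C ∩ U) H P := by
    refine ⟨hmem, fun a b h => (hP a b h).1, hrev, ?_, ?_⟩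
    · intro a b h w hw hwC
      have := (hP a b h).mem_or_eq h.ne hw
      have hwC' := hwC.1
      tauto
    · intro a b h c d h' w hw hw' hwC
      exact (hP a b h).ends_eq hx hy hconv (hP c d h') h.ne h'.ne hw hw'
        fun hC => hwC ⟨hC, hsupp _ _ _ w hw⟩
  have hadj : ∀ n i j, IsSegment C (p n : G.Walk x y) i j →
      H.Adj ((p n : G.Walk x y).getVert i) ((p n : G.Walk x y).getVert j) :=
    fun n i j h => ⟨h.getVert_ne (p n).2, h.exists_isCandidate hxy⟩
  have hHxy : H.Adj x y := by
    obtain ⟨q, hq, he⟩ := exists_isPath_edge_mem hxy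
    exact ⟨hxy.ne, q, hq, Or.inl ⟨rfl, he⟩⟩
  have hseq : ∀ a ∈ C ∩ U, ∃ N, ∀ n, N < n → a ∈ (p n : G.Walk x y).support := by
    rintro a ⟨haC, m, hm⟩
    exact ⟨m, fun n hn => (hconv m n hn a hm).1 haC⟩
  refine ⟨C ∩ U, H, P, hsys, ⟨hx, hxU⟩, ⟨hy, hyU⟩, ⟨hHxy, ?_⟩, ?_, ?_⟩
  · rcases (hP x y hHxy).2 with ⟨-, h⟩ | ⟨h, -⟩
    · exact h
    · exact absurd rfl h
  · intro a ha b hb A haA hbA hfin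
    obtain ⟨N, hN⟩ := hseq a ha
    obtain ⟨N', hN'⟩ := hseq b hb
    -- Every late path contains both `a` and `b`, hence has a segment across the cut. Each edge of
    -- `H` accounts for finitely many paths, so finitely many edges cannot suffice.
    have hsub : Set.Ioi (max N N') ⊆
        ⋃ e ∈ {e : V × V | e.1 ∈ A ∧ e.2 ∉ A ∧ H.Adj e.1 e.2},
          ({n | ∃ i j, IsSegment C (p n : G.Walk x y) i j ∧
            (p n : G.Walk x y).getVert i = e.1 ∧ (p n : G.Walk x y).getVert j = e.2} ∪
          {n | ∃ i j, IsSegment C (p n : G.Walk x y) i j ∧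
            (p n : G.Walk x y).getVert i = e.2 ∧ (p n : G.Walk x y).getVert j = e.1}) := by
      intro n hn
      have hn' := max_lt_iff.1 (Set.mem_Ioi.1 hn)
      obtain ⟨i, hi, hil⟩ := Walk.mem_support_iff_exists_getVert.1 (hN n hn'.1)
      obtain ⟨j, hj, hjl⟩ := Walk.mem_support_iff_exists_getVert.1 (hN' n hn'.2)
      obtain ⟨k, l, hkl, hll, hk, hl, hbet, hne⟩ : ∃ k l, k < l ∧
          l ≤ (p n : G.Walk x y).length ∧ (p n : G.Walk x y).getVert k ∈ C ∧
          (p n : G.Walk x y).getVert l ∈ C ∧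
          (∀ m, k < m → m < l → (p n : G.Walk x y).getVert m ∉ C) ∧
          ¬ ((p n : G.Walk x y).getVert k ∈ A ↔ (p n : G.Walk x y).getVert l ∈ A) := by
        rcases lt_trichotomy i j with h | h | h
        · obtain ⟨k, l, h1, h2, h3⟩ := exists_consecutive
            (P := fun k => (p n : G.Walk x y).getVert k ∈ C)
            (Q := fun k => (p n : G.Walk x y).getVert k ∈ A) h (by rw [hi]; exact ha.1)
            (by rw [hj]; exact hb.1) (by rw [hi, hj]; tauto)
          exact ⟨k, l, h1, by omega, h3⟩
        · subst h
          rw [hi] at hj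
          exact absurd (hj ▸ haA) hbA
        · obtain ⟨k, l, h1, h2, h3⟩ := exists_consecutive
            (P := fun k => (p n : G.Walk x y).getVert k ∈ C)
            (Q := fun k => (p n : G.Walk x y).getVert k ∈ A) h (by rw [hj]; exact hb.1)
            (by rw [hi]; exact ha.1) (by rw [hi, hj]; tauto)
          exact ⟨k, l, h1, by omega, h3⟩
      have hseg : IsSegment C (p n : G.Walk x y) k l := ⟨hkl, hll, hk, hl, hbet⟩
      simp only [Set.mem_iUnion]
      by_cases hkA : (p n : G.Walk x y).getVert k ∈ A
      · exact ⟨(_, _), ⟨hkA, by tauto, hadj n k l hseg⟩, Or.inl ⟨k, l, hseg, rfl, rfl⟩⟩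
      · exact ⟨(_, _), ⟨by tauto, hkA, (hadj n k l hseg).symm⟩, Or.inr ⟨k, l, hseg, rfl, rfl⟩⟩
    refine Set.Ioi_infinite _ ((hfin.biUnion fun e he => ?_).subset hsub)
    have hne : e.1 ≠ e.2 := he.2.2.ne
    exact (finite_segments_of_finSep hedge hconv (hsep _ _ hne)).union
      (finite_segments_of_finSep hedge hconv (hsep _ _ hne.symm))
  · intro a ha b hb hab
    exact hsys.finSep_of_finSep_host ha hb (hsep a b hab)

end FareyUnique

/-! ### Contracting a finite set, and lifting back to subgraphs. -/

namespace FareyUnique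

open SimpleGraph

variable {V : Type*} {G : SimpleGraph V}

theorem EdgeLinked.comap {W : Type*} {f : W → V} (hf : ∀ a b, G.Adj a b → a ∈ Set.range f) {a b : W}
    (hinj : Function.Injective f) (h : EdgeLinked G (f a) (f b)) :
    EdgeLinked (G.comap f) a b := by
  intro A ha hb hfin
  refine h (f '' A) ⟨a, ha, rfl⟩ (fun ⟨c, hc, he⟩ => hb (hinj he ▸ hc)) ?_
  refine (hfin.image (Prod.map f f)).subset ?_
  rintro ⟨_, d⟩ ⟨⟨c, hc, rfl⟩, hd, hcd⟩
  obtain ⟨d, rfl⟩ := hf _ _ hcd.symm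
  exact ⟨(c, d), ⟨hc, fun h => hd ⟨d, h, rfl⟩, hcd⟩, rfl⟩

theorem FinSep.comap {W : Type*} {f : W → V} {a b : W}
    (hinj : Function.Injective f) (h : FinSep G (f a) (f b)) : FinSep (G.comap f) a b := by
  obtain ⟨R, hR⟩ := h
  refine ⟨f ⁻¹' R, hR.left_mem, hR.right_notMem, fun w hw hwb => hinj (hR.eq_of_adj _ hw hwb), ?_⟩
  refine (hR.finite_boundary.preimage hinj.injOn).subset ?_
  rintro w ⟨hw, hwb, z, hz, hzw⟩
  exact ⟨hw, fun h => hwb (hinj h), f z, hz, hzw⟩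

theorem exists_walk_lift {W : Type*} {Γ : SimpleGraph W} {φ : W → V} (hφ : Function.Injective φ)
    {c d : V} (q : G.Walk c d) (hq : ∀ w ∈ q.support, w ∈ Set.range φ)
    (hadj : ∀ s t, s(φ s, φ t) ∈ q.edges → Γ.Adj s t) {a b : W} (ha : φ a = c) (hb : φ b = d) :
    ∃ q' : Γ.Walk a b, q'.support.map φ = q.support ∧ q'.edges.map (Sym2.map φ) = q.edges := by
  induction q generalizing a with
  | nil =>
    obtain rfl := hφ (ha.trans hb.symm)
    exact ⟨.nil, by simp [ha], by simp⟩
  | cons h q ih =>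
    obtain ⟨m, hm⟩ := hq _ (List.mem_cons_of_mem _ q.start_mem_support)
    obtain ⟨q', h1, h2⟩ := ih (fun w hw => hq w (List.mem_cons_of_mem _ hw))
      (fun s t he => hadj s t (List.mem_cons_of_mem _ he)) hm hb
    have ham : Γ.Adj a m := hadj a m (by simp [ha, hm])
    exact ⟨.cons ham q', by simp [ha, h1], by simp [ha, hm, h2]⟩

/-- Passes from a path system inside a larger host to a graph `Γ` consisting of exactly its vertices
and edges, on a vertex type of its own. -/
theorem PathSystem.isSubdividedPiGraph {C : Set V} {H : SimpleGraph V}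
    {P : ∀ a b, H.Adj a b → G.Walk a b} (h : PathSystem G C H P)
    (hlink : ∀ a ∈ C, ∀ b ∈ C, EdgeLinked H a b) (hsep : ∀ a ∈ C, ∀ b ∈ C, a ≠ b → FinSep H a b)
    (hC : C.Nontrivial) {W : Type*} {Γ : SimpleGraph W} {φ : W → V} (hφ : Function.Injective φ)
    (hrange : Set.range φ = C ∪ {w | ∃ a b, w ∈ trace P a b})
    (hΓ : ∀ s t, Γ.Adj s t ↔ ∃ a b h, s(φ s, φ t) ∈ (P a b h).edges) :
    IsSubdividedPiGraph Γ (φ ⁻¹' C) := by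
  have hCr : ∀ a ∈ C, ∃ s : φ ⁻¹' C, φ s = a := by
    intro a ha
    obtain ⟨s, rfl⟩ := hrange.symm.subset (Or.inl ha)
    exact ⟨⟨s, ha⟩, rfl⟩
  have hinj : Function.Injective (fun s : φ ⁻¹' C => φ s) :=
    hφ.comp Subtype.val_injective
  have hnt : Nontrivial (φ ⁻¹' C) := by
    obtain ⟨a, ha, b, hb, hab⟩ := hC
    obtain ⟨s, rfl⟩ := hCr a ha
    obtain ⟨t, rfl⟩ := hCr b hb
    exact ⟨s, t, fun e => hab (e ▸ rfl)⟩
  have hlift : ∀ (s t : φ ⁻¹' C) (hst : (H.comap fun s : φ ⁻¹' C => φ s).Adj s t),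
      ∃ q : Γ.Walk (s : W) (t : W), q.support.map φ = (P (φ s) (φ t) hst).support ∧
        q.edges.map (Sym2.map φ) = (P (φ s) (φ t) hst).edges := fun s t hst =>
    exists_walk_lift hφ _ (fun w hw => hrange.symm.subset (Or.inr ⟨_, _, hst, hw⟩))
      (fun s' t' he => (hΓ s' t').2 ⟨_, _, hst, he⟩) rfl rfl
  choose Q hQs hQe using hlift
  have hmem : ∀ s t hst w, w ∈ (Q s t hst).support ↔ φ w ∈ (P (φ s) (φ t) hst).support := by
    intro s t hst w
    rw [← hQs, List.mem_map_of_injective hφ]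
  have hmem' : ∀ s t hst u v, s(u, v) ∈ (Q s t hst).edges ↔
      s(φ u, φ v) ∈ (P (φ s) (φ t) hst).edges := by
    intro s t hst u v
    rw [← hQe, ← Sym2.map_mk, List.mem_map_of_injective (Sym2.map.injective hφ)]
  refine ⟨H.comap fun s : φ ⁻¹' C => φ s, isPiGraph_of_edgeLinked_of_finSep ?_ ?_, Q, ?_, ?_, ?_,
    ?_, ?_, ?_⟩
  · intro s t _
    exact EdgeLinked.comap (fun a b hab => hCr a (h.mem a b hab)) hinj (hlink _ s.2 _ t.2)
  · intro s t hst
    exact FinSep.comap hinj (hsep _ s.2 _ t.2 fun e => hst (hinj e))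
  · intro s t hst
    have h1 := (h.isPath _ _ hst).support_nodup
    rw [← hQs] at h1
    exact Walk.IsPath.mk' h1.of_map
  · intro s t hst
    refine Walk.ext_support (List.map_injective_iff.2 hφ ?_)
    rw [hQs, Walk.support_reverse, List.map_reverse, hQs, h.reverse _ _ hst, Walk.support_reverse]
  · intro s t hst w hw hwC
    exact (h.interior _ _ hst _ ((hmem _ _ _ _).1 hw) hwC).imp (fun e => hφ e) (fun e => hφ e)
  · intro s t hst s' t' hst' w hw hw' hwC
    have := h.disjoint _ _ hst _ _ hst' _ ((hmem _ _ _ _).1 hw) ((hmem _ _ _ _).1 hw') hwC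
    exact Sym2.map.injective hinj this
  · intro w hw
    rcases hrange.subset ⟨w, rfl⟩ with hwC | ⟨a, b, hab, hwab⟩
    · exact absurd hwC hw
    · obtain ⟨s, rfl⟩ := hCr a (h.mem _ _ hab)
      obtain ⟨t, rfl⟩ := hCr b (h.mem _ _ hab.symm)
      exact ⟨s, t, hab, (hmem _ _ _ _).2 hwab⟩
  · intro e he
    induction e with
    | h u v =>
      obtain ⟨a, b, hab, h1⟩ := (hΓ u v).1 he
      obtain ⟨s, rfl⟩ := hCr a (h.mem _ _ hab)
      obtain ⟨t, rfl⟩ := hCr b (h.mem _ _ hab.symm)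
      exact ⟨s, t, hab, (hmem' _ _ _ _ _).2 h1⟩

/-- The graph on `D` together with a vertex `none` that arises by contracting `X`. Vertices outside
`D` are isolated. -/
def contraction (G : SimpleGraph V) (D X : Set V) : SimpleGraph (Option V) where
  Adj
    | some a, some b => a ∈ D ∧ b ∈ D ∧ G.Adj a b
    | some a, none => a ∈ D ∧ ∃ x ∈ X, G.Adj a x
    | none, some b => b ∈ D ∧ ∃ x ∈ X, G.Adj b x
    | none, none => False
  symm := ⟨by
    rintro (_ | a) (_ | b) h
    · exact h
    · exact h
    · exact h
    · exact ⟨h.2.1, h.1, h.2.2.symm⟩⟩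
  loopless := ⟨by
    rintro (_ | a) h
    · exact h
    · exact h.2.2.ne rfl⟩

/-- For `a ∉ X`, the sides of `a` against the finitely many vertices of `X` are intersected; new
boundary vertices lie in one of their boundaries or in `X`. For `a ∈ X`, the vertex is isolated. -/
theorem finSep_contraction_none (hsep : ∀ a b, a ≠ b → FinSep G a b) {D X : Set V}
    (hX : X.Finite) (hDX : Disjoint D X) (a : V) : FinSep (contraction G D X) (some a) none := by
  by_cases haX : a ∈ X
  · have haD : a ∉ D := fun h => Set.disjoint_left.1 hDX h haX
    refine ⟨{some a}, rfl, by simp, fun w hw _ => hw, Set.finite_empty.subset ?_⟩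
    rintro (_ | w) ⟨-, -, z, rfl, hz⟩ <;> exact haD hz.1
  have hR : ∀ x : X, ∃ R, IsSide G a x R := fun x => hsep a x fun e => haX (e ▸ x.2)
  choose R hR using hR
  have := hX.to_subtype
  refine ⟨some '' {w | ∀ x, w ∈ R x}, ⟨a, fun x => (hR x).left_mem, rfl⟩, by simp, ?_, ?_⟩
  · rintro _ ⟨w, hw, rfl⟩ ⟨-, x, hx, hwx⟩
    rw [(hR ⟨x, hx⟩).eq_of_adj w (hw _) hwx]
  · refine (((Set.finite_iUnion fun x => (hR x).finite_boundary).union hX).image some).subset ?_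
    rintro (_ | w) ⟨hw, hwn, _, ⟨z, hz, rfl⟩, hzw⟩
    · exact absurd rfl hwn
    · refine ⟨w, ?_, rfl⟩
      by_contra hno
      refine hw ⟨w, fun x => ?_, rfl⟩
      by_contra hwx
      refine hno (Or.inl (Set.mem_iUnion.2 ⟨x, hwx, fun e => ?_, z, hz x, hzw.2.2⟩))
      exact hno (Or.inr (e ▸ x.2))

theorem finSep_contraction (hsep : ∀ a b, a ≠ b → FinSep G a b) {D X : Set V}
    (hX : X.Finite) (hDX : Disjoint D X) (a b : Option V) (hab : a ≠ b) :
    FinSep (contraction G D X) a b := by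
  rcases a with _ | a <;> rcases b with _ | b
  · exact absurd rfl hab
  · exact (finSep_contraction_none hsep hX hDX b).symm
  · exact finSep_contraction_none hsep hX hDX a
  · obtain ⟨R, hR⟩ := hsep a b fun e => hab (e ▸ rfl)
    refine ⟨some '' R, ⟨a, hR.left_mem, rfl⟩, ?_, ?_, ?_⟩
    · rintro ⟨c, hc, he⟩
      exact hR.right_notMem (Option.some.inj he ▸ hc)
    · rintro _ ⟨w, hw, rfl⟩ hwb
      rw [hR.eq_of_adj w hw hwb.2.2]
    · refine ((hR.finite_boundary.image some).union (Set.finite_singleton none)).subset ?_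
      rintro (_ | w) ⟨hw, hwb, _, ⟨z, hz, rfl⟩, hzw⟩
      · exact Or.inr rfl
      · exact Or.inl ⟨w, ⟨fun h => hw ⟨w, h, rfl⟩, fun e => hwb (e ▸ rfl), z, hz, hzw.2.2⟩, rfl⟩

/-- Contraction merges only finitely many edges at a time, because `X` is finite, so infinite cuts
stay infinite. -/
theorem edgeLinked_contraction {D X : Set V} (hX : X.Finite) {u : V} (hu : u ∈ D)
    (h : ∀ A ⊆ D, u ∈ A →
      {p : V × V | p.1 ∈ A ∧ p.2 ∈ (D \ A) ∪ X ∧ G.Adj p.1 p.2}.Infinite) :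
    EdgeLinked (contraction G D X) (some u) none := by
  intro A hA hnA hfin
  refine h {w | w ∈ D ∧ some w ∈ A} (fun w hw => hw.1) ⟨hu, hA⟩ ?_
  refine ((hfin.preimage (f := Prod.map some some)
    ((Option.some_injective V).prodMap (Option.some_injective V)).injOn).union
    ((hfin.preimage (f := fun w => (some w, none)) ?_).prod hX)).subset ?_
  · intro w _ w' _ he
    simpa using he
  · rintro ⟨w, w'⟩ ⟨⟨hwD, hwA⟩, hw' | hw', hww'⟩
    · exact Or.inl ⟨hwA, fun hA' => hw'.2 ⟨hw'.1, hA'⟩, hwD, hw'.1, hww'⟩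
    · exact Or.inr ⟨⟨hwA, hnA, hwD, w', hw', hww'⟩, hw'⟩

theorem exists_subgraph_of_edgeLinked_contraction (hsep : ∀ a b, a ≠ b → FinSep G a b)
    {D X : Set V} (hX : X.Finite) (hDX : Disjoint D X) {u : V}
    (hlink : EdgeLinked (contraction G D X) (some u) none)
    (hadj : (contraction G D X).Adj (some u) none) :
    ∃ K : G.Subgraph, X ⊆ K.verts ∧ K.verts ⊆ D ∪ X ∧
      K.induce X = (⊤ : G.Subgraph).induce X ∧
      ∃ hu : u ∈ K.verts \ X,
        (∃ B : Set (Option ↥(K.verts \ X)), IsSubdividedPiGraph (contract K X) B ∧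
          some ⟨u, hu⟩ ∈ B ∧ none ∈ B) ∧
        (contract K X).Adj (some ⟨u, hu⟩) none := by
  obtain ⟨C, H, P, hP, huC, hnC, ⟨hun, hedge⟩, hHlink, hHsep⟩ :=
    exists_pathSystem_of_edgeLinked (finSep_contraction hsep hX hDX) hlink hadj
  set U : Set (Option V) := C ∪ {w | ∃ a b, w ∈ trace P a b} with hU
  set E : Option V → Option V → Prop := fun s t => ∃ a b h, s(s, t) ∈ (P a b h).edges with hE
  have hEsymm : ∀ s t, E s t → E t s := by
    rintro s t ⟨a, b, h, he⟩
    exact ⟨a, b, h, Sym2.eq_swap (a := s) ▸ he⟩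
  have hEadj : ∀ s t, E s t → (contraction G D X).Adj s t := by
    rintro s t ⟨a, b, h, he⟩
    exact (P a b h).adj_of_mem_edges he
  have hEU : ∀ s t, E s t → s ∈ U := by
    rintro s t ⟨a, b, h, he⟩
    exact Or.inr ⟨a, b, h, Walk.fst_mem_support_of_mem_edges _ he⟩
  have hUD : ∀ w, some w ∈ U → w ∈ D := by
    have hsomeD : ∀ w t, (contraction G D X).Adj (some w) t → w ∈ D := by
      rintro w (_ | t) h <;> exact h.1
    have htrace : ∀ w a b, some w ∈ trace P a b → w ∈ D := by
      rintro w a b ⟨hab, hw⟩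
      obtain ⟨t, ht⟩ : ∃ t, s(some w, t) ∈ (P a b hab).edges := by
        rw [Walk.mem_support_iff_exists_mem_edges_of_not_nil (Walk.not_nil_of_ne hab.ne)] at hw
        obtain ⟨e, he, hwe⟩ := hw
        obtain ⟨t, rfl⟩ := Sym2.mem_iff_exists.1 hwe
        exact ⟨t, he⟩
      exact hsomeD w t ((P a b hab).adj_of_mem_edges ht)
    rintro w (hw | ⟨a, b, hw⟩)
    · by_cases hwu : w = u
      · rw [hwu]
        exact hadj.1
      · have hlink' := hHlink _ hw _ huC {some w} rfl (by simpa using fun h => hwu h.symm)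
        obtain ⟨⟨p, q⟩, hp, -, hpq⟩ := hlink'.nonempty
        have hp' : p = some w := hp
        subst hp'
        exact htrace w _ q (left_mem_trace hpq)
    · exact htrace w a b hw
  -- All edges of `G` inside `X` are kept, so that the two final subgraphs agree there. An edge of
  -- the system at `none` is lifted to all edges of `G` it stands for.
  let K : G.Subgraph :=
    { verts := X ∪ {a | some a ∈ U}
      Adj := fun a b => G.Adj a b ∧ (a ∈ X ∧ b ∈ X ∨ E (some a) (some b) ∨
        a ∈ X ∧ E none (some b) ∨ b ∈ X ∧ E (some a) none)
      adj_sub := fun h => h.1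
      edge_vert := by
        rintro a b ⟨-, h | h | h | h⟩
        · exact Or.inl h.1
        · exact Or.inr (hEU _ _ h)
        · exact Or.inl h.1
        · exact Or.inr (hEU _ _ h.2)
      symm := ⟨by
        rintro a b ⟨h, h'⟩
        refine ⟨h.symm, ?_⟩
        rcases h' with h' | h' | h' | h'
        · exact Or.inl h'.symm
        · exact Or.inr (Or.inl (hEsymm _ _ h'))
        · exact Or.inr (Or.inr (Or.inr ⟨h'.1, hEsymm _ _ h'.2⟩))
        · exact Or.inr (Or.inr (Or.inl ⟨h'.1, hEsymm _ _ h'.2⟩))⟩ }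
  have hXD : ∀ x ∈ X, x ∉ D := fun x hx hD => Set.disjoint_left.1 hDX hD hx
  have huX : u ∉ X := fun h => hXD u h hadj.1
  have huK : u ∈ K.verts \ X := ⟨Or.inr (Or.inl huC), huX⟩
  let φ : Option ↥(K.verts \ X) → Option V := Option.map Subtype.val
  have hφ : Function.Injective φ := Option.map_injective Subtype.val_injective
  have hadjnone : ∀ a : ↥(K.verts \ X), (contract K X).Adj (some a) none ↔
      E (some (a : V)) none := by
    intro a
    constructor
    · rintro ⟨x, hx, -, h | h | h | h⟩
      · exact absurd h.1 a.2.2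
      · exact absurd (hUD _ (hEU _ _ (hEsymm _ _ h))) (hXD x hx)
      · exact absurd h.1 a.2.2
      · exact h.2
    · intro h
      obtain ⟨-, x, hx, hax⟩ := hEadj _ _ h
      exact ⟨x, hx, hax, Or.inr (Or.inr (Or.inr ⟨hx, h⟩))⟩
  have hΓ : ∀ s t, (contract K X).Adj s t ↔ E (φ s) (φ t) := by
    rintro (_ | a) (_ | b)
    · exact ⟨fun h => h.elim, fun h => (hEadj _ _ h).elim⟩
    · rw [adj_comm, hadjnone]
      exact ⟨hEsymm _ _, hEsymm _ _⟩
    · exact hadjnone a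
    · constructor
      · rintro ⟨-, h | h | h | h⟩
        · exact absurd h.1 a.2.2
        · exact h
        · exact absurd h.1 a.2.2
        · exact absurd h.1 b.2.2
      · intro h
        exact ⟨(hEadj _ _ h).2.2, Or.inr (Or.inl h)⟩
  have hrange : Set.range φ = U := by
    ext (_ | w)
    · exact ⟨fun _ => Or.inl hnC, fun _ => ⟨none, rfl⟩⟩
    · constructor
      · rintro ⟨_ | a, ha⟩
        · exact absurd ha (by simp [φ])
        · have ha' : (a : V) = w := by simpa [φ] using ha
          rw [← ha']
          exact a.2.1.resolve_left a.2.2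
      · intro hw
        exact ⟨some ⟨w, Or.inr hw, fun hx => hXD w hx (hUD w hw)⟩, rfl⟩
  refine ⟨K, Set.subset_union_left, ?_, ?_, huK, ⟨φ ⁻¹' C, ?_, huC, hnC⟩, ?_⟩
  · rintro w (hw | hw)
    · exact Or.inr hw
    · exact Or.inl (hUD w hw)
  · ext a b
    · rfl
    · exact ⟨fun h => ⟨h.1, h.2.1, h.2.2.1⟩, fun h => ⟨h.1, h.2.1, h.2.2, Or.inl ⟨h.1, h.2.1⟩⟩⟩
  · exact hP.isSubdividedPiGraph hHlink hHsep ⟨_, huC, _, hnC, by simp⟩ hφ hrange hΓ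
  · exact (hadjnone ⟨u, huK⟩).2 ⟨_, _, hun, hedge⟩

end FareyUnique

/-! ### Linkage inside one side, and the choice of `X`. -/

namespace FareyUnique

open SimpleGraph

variable {V : Type*} {G : SimpleGraph V}

/-- The vertex `s` cannot be separated from `u` by finitely many edges within `R ∪ {s}`. -/
def LinkedWithin (G : SimpleGraph V) (R : Set V) (u s : V) : Prop :=
  ∀ A ⊆ R, u ∈ A → {p : V × V | p.1 ∈ A ∧ (p.2 ∈ R \ A ∨ p.2 = s) ∧ G.Adj p.1 p.2}.Infinite

theorem IsSide.exists_finite_edges {u v : V} {R : Set V} (h : IsSide G u v R) :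
    ∃ F : Set (Sym2 V), F.Finite ∧ ∀ p : G.Walk u v, (∀ e ∈ p.edges, e ∉ F) →
      ∃ s ∈ p.support, s ≠ u ∧ s ≠ v ∧ s ∉ R ∧ LinkedWithin G R u s := by
  classical
  have hA : ∀ s, ∃ A ⊆ R, u ∈ A ∧ (¬ LinkedWithin G R u s →
      {p : V × V | p.1 ∈ A ∧ (p.2 ∈ R \ A ∨ p.2 = s) ∧ G.Adj p.1 p.2}.Finite) := by
    intro s
    by_cases hs : LinkedWithin G R u s
    · exact ⟨R, subset_rfl, h.left_mem, fun h => absurd hs h⟩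
    · simp only [LinkedWithin, not_forall, Set.not_infinite] at hs
      obtain ⟨A, hAR, hu, hfin⟩ := hs
      exact ⟨A, hAR, hu, fun _ => hfin⟩
  choose A hAR huA hfin using hA
  -- Each of the finitely many boundary vertices that `u` is not linked to contributes one finite
  -- cut. A walk first leaving `R` at such a vertex would have to cross its cut.
  refine ⟨{s(u, v)} ∪ ⋃ s ∈ boundary G v R ∩ {s | ¬ LinkedWithin G R u s},
    (fun p : V × V => s(p.1, p.2)) ''
      {p | p.1 ∈ A s ∧ (p.2 ∈ R \ A s ∨ p.2 = s) ∧ G.Adj p.1 p.2},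
    (Set.finite_singleton _).union ((h.finite_boundary.inter_of_left _).biUnion
      fun s hs => (hfin s hs.2).image _), fun p hp => ?_⟩
  have hex : ∃ k, p.getVert k ∉ R := ⟨p.length, by simpa using h.right_notMem⟩
  obtain ⟨k, hk⟩ : ∃ k, Nat.find hex = k + 1 := by
    refine Nat.exists_eq_succ_of_ne_zero fun h0 => ?_
    have := Nat.find_spec hex
    rw [h0] at this
    exact this (by simpa using h.left_mem)
  have hout : p.getVert (k + 1) ∉ R := hk ▸ Nat.find_spec hex
  have hin : ∀ i ≤ k, p.getVert i ∈ R := fun i hi =>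
    not_not.1 (Nat.find_min hex (m := i) (by omega))
  have hkl : k + 1 ≤ p.length := hk ▸ Nat.find_min' hex (by simpa using h.right_notMem)
  have hadj : ∀ i ≤ k, G.Adj (p.getVert i) (p.getVert (i + 1)) :=
    fun i hi => p.adj_getVert_succ (by omega)
  have hedge : ∀ i ≤ k, s(p.getVert i, p.getVert (i + 1)) ∈ p.edges :=
    fun i hi => (Walk.mk_mem_edges_iff_exists _).2 ⟨i, by omega, rfl⟩
  have hne : p.getVert (k + 1) ≠ v := by
    intro he
    have hkv := hadj k le_rfl
    rw [he] at hkv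
    have h1 := h.eq_of_adj _ (hin k le_rfl) hkv
    refine hp _ (hedge k le_rfl) (Or.inl ?_)
    rw [h1, he]
    rfl
  refine ⟨_, p.getVert_mem_support (k + 1), fun e => hout (e.symm ▸ h.left_mem), hne, hout, ?_⟩
  by_contra hbad
  obtain ⟨i, -, hik, hi, hi'⟩ := exists_step
    (P := fun i => p.getVert i ∈ A (p.getVert (k + 1))) (Nat.zero_le (k + 1))
    (by simpa using huA _) (fun h => hout (hAR _ h))
  refine hp _ (hedge i (by omega)) (Or.inr ?_)
  simp only [Set.mem_iUnion]
  refine ⟨_, ⟨⟨hout, hne, _, hin k le_rfl, hadj k le_rfl⟩, hbad⟩,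
    (p.getVert i, p.getVert (i + 1)), ⟨hi, ?_, hadj i (by omega)⟩, rfl⟩
  by_cases he : i = k
  · exact Or.inr (by rw [he])
  · exact Or.inl ⟨hin _ (by omega), hi'⟩

theorem LinkedWithin.edgeLinked_contraction {R X : Set V} {u s : V} (h : LinkedWithin G R u s)
    (hX : X.Finite) (huR : u ∈ R) (huX : u ∉ X) (hs : s ∈ X) :
    EdgeLinked (contraction G (R \ X) X) (some u) none := by
  refine FareyUnique.edgeLinked_contraction hX ⟨huR, huX⟩ fun A hA huA => ?_
  refine (h A (fun w hw => (hA hw).1) huA).mono ?_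
  rintro ⟨w, w'⟩ ⟨hw, hw', hadj⟩
  refine ⟨hw, ?_, hadj⟩
  rcases hw' with hw' | hw'
  · by_cases hX' : w' ∈ X
    · exact Or.inr hX'
    · exact Or.inl ⟨⟨hw'.1, hX'⟩, hw'.2⟩
  · have hw'' : w' = s := hw'
    exact Or.inr (hw'' ▸ hs)

theorem exists_inner_walk {u v : V} (p : G.Walk u v) (hp : p.IsPath) (huv : u ≠ v)
    (he : s(u, v) ∉ p.edges) : ∃ (a b : V) (q : G.Walk a b), G.Adj u a ∧ G.Adj v b ∧
      u ∉ q.support ∧ v ∉ q.support ∧ ∀ w ∈ p.support, w ≠ u → w ≠ v → w ∈ q.support := by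
  cases p with
  | nil => exact absurd rfl huv
  | @cons _ a _ h p =>
    rw [Walk.cons_isPath_iff] at hp
    have hav : a ≠ v := by
      rintro rfl
      simp at he
    induction p using Walk.concatRec with
    | Hnil => exact absurd rfl hav
    | @Hconcat a b v q h' _ =>
      refine ⟨a, b, q, h, h'.symm, ?_, ?_, ?_⟩
      · intro hu
        exact hp.2 (by simp [Walk.support_concat, hu])
      · exact ((Walk.concat_isPath_iff _).1 hp.1).2
      · intro w hw hwu hwv
        rw [Walk.support_cons, Walk.support_concat] at hw
        simpa [hwu, hwv] using hw

end FareyUnique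

theorem theorem6p1 {V : Type*} (G : SimpleGraph V) (B : Set V)
    (hG : FareyUnique.IsSubdividedPiGraph G B)
    (u v : V) (hu : u ∈ B) (hv : v ∈ B) (huv : u ≠ v) :
    ∃ (Hu Hv : G.Subgraph) (X : Set V),
      X = Hu.verts ∩ Hv.verts ∧ X.Nonempty ∧
      (Hu.induce X = Hv.induce X ∧ X.Finite ∧
        (Hu.induce X).Connected ∧ (Hv.induce X).Connected) ∧
      (u ∉ X ∧ v ∉ X) ∧
      ∃ (hu' : u ∈ Hu.verts \ X) (hv' : v ∈ Hv.verts \ X),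
        (∃ Bu : Set (Option ↥(Hu.verts \ X)),
          FareyUnique.IsSubdividedPiGraph (FareyUnique.contract Hu X) Bu ∧
          some ⟨u, hu'⟩ ∈ Bu ∧ none ∈ Bu) ∧
        (∃ Bv : Set (Option ↥(Hv.verts \ X)),
          FareyUnique.IsSubdividedPiGraph (FareyUnique.contract Hv X) Bv ∧
          some ⟨v, hv'⟩ ∈ Bv ∧ none ∈ Bv) ∧
        (FareyUnique.contract Hu X).Adj (some ⟨u, hu'⟩) none ∧
        (FareyUnique.contract Hv X).Adj (some ⟨v, hv'⟩) none := by
  have hsep : ∀ a b, a ≠ b → FareyUnique.FinSep G a b := fun a b hab => hG.finSep hab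
  obtain ⟨R, hR⟩ := hsep u v huv
  have hR' := hR.symm
  set R' := (R ∪ FareyUnique.boundary G v R)ᶜ with hR'def
  obtain ⟨F, hF, hFp⟩ := hR.exists_finite_edges
  obtain ⟨F', hF', hFp'⟩ := hR'.exists_finite_edges
  -- Avoiding the edge `uv` as well ensures that the path has inner vertices.
  obtain ⟨p, hp, hpF⟩ := (hG.edgeLinked hu hv).exists_path
    ((hF.union hF').union (Set.finite_singleton s(u, v)))
  obtain ⟨s, hs, hsu, hsv, -, hlink⟩ := hFp p fun e he h => hpF e he (Or.inl (Or.inl h))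
  obtain ⟨t, ht, htv, htu, -, hlink'⟩ := hFp' p.reverse fun e he h =>
    hpF e (by simpa using he) (Or.inl (Or.inr h))
  obtain ⟨a, b, q, hua, hvb, huq, hvq, hq⟩ := FareyUnique.exists_inner_walk p hp huv
    fun h => hpF _ h (Or.inr rfl)
  set X : Set V := {w | w ∈ q.support} with hX
  have hXfin : X.Finite := List.finite_toSet q.support
  obtain ⟨Hu, hXu, huD, hindu, hu', hBu, hadju⟩ :=
    FareyUnique.exists_subgraph_of_edgeLinked_contraction hsep hXfin Set.disjoint_sdiff_left
      (hlink.edgeLinked_contraction hXfin hR.left_mem huq (hq s hs hsu hsv))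
      ⟨⟨hR.left_mem, huq⟩, a, q.start_mem_support, hua⟩
  obtain ⟨Hv, hXv, hvD, hindv, hv', hBv, hadjv⟩ :=
    FareyUnique.exists_subgraph_of_edgeLinked_contraction hsep hXfin Set.disjoint_sdiff_left
      (hlink'.edgeLinked_contraction hXfin hR'.left_mem hvq (hq t (by simpa using ht) htu htv))
      ⟨⟨hR'.left_mem, hvq⟩, b, q.end_mem_support, hvb⟩
  have hconn : ((⊤ : G.Subgraph).induce X).Connected :=
    SimpleGraph.connected_induce_iff.1 q.connected_induce_support
  refine ⟨Hu, Hv, X, ?_, ⟨a, q.start_mem_support⟩, ⟨hindu.trans hindv.symm, hXfin, hindu ▸ hconn,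
    hindv ▸ hconn⟩, ⟨huq, hvq⟩, hu', hv', hBu, hBv, hadju, hadjv⟩
  -- Outside `X` the subgraphs lie in the disjoint sides `R` and `R'`.
  refine (Set.subset_inter hXu hXv).antisymm ?_
  rintro w ⟨hw, hw'⟩
  rcases huD hw with h | h
  · rcases hvD hw' with h' | h'
    · exact absurd (Or.inl h.1) h'.1
    · exact h'
  · exact h
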